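/- Let $X,U$ be Banach spaces, $\mathcal Q$ a nonempty set, and $A$ the infinitesimal generator of a $C_0$-group $(T_t)_{t\in\mathbb R}$ of bounded linear operators on $X$. For $q\in\mathcal Q$ let $f_q:X\times U\to X$ be Lipschitz with a constant $L_f$ independent of $q$ and $f_q(0,0)=0$, and let $K:X\to U$ be Lipschitz with $K(0)=0$. Let $\mathrm{PC}$ be the set of piecewise constant $\sigma:\mathbb R_+\to\mathcal Q$, i.e. those for which there are $0=t_0<t_1<\cdots$ with $t_k\to\infty$ such that $\sigma$ is constant on each $[t_k,t_{k+1})$. Let $\Sigma_0$ be the closed-loop system $\dot x=Ax+f_{\sigma(t)}(x,K(x))$, whose transition map is $\phi_0(t,x_0,\sigma)=x(t)$, where, for $x_0\in X$ and $\sigma\in\mathrm{PC}$, $x$ is the mild solution, i.e. the continuous function $x:\mathbb R_+\to X$ with $$x(t)=T_tx_0+\int_0^tT_{t-s}f_{\sigma(s)}\big(x(s),K(x(s))\big)\,ds,\qquad t\ge0 .$$ Given sampling instants $0=s_0<s_1<\cdots$ with $s_k\to\infty$, let $\Sigma$ be the predictor-based sampled-data system $\dot x(t)=Ax(t)+f_{\sigma(t)}(x(t),K(T_{t-s_k}x(s_k)))$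 for $s_k\le t<s_{k+1}$, $x(0)=x_0$. Its solutions are the continuous $x:\mathbb R_+\to X$ with $x(0)=x_0$ such that, for all $k\ge 0$ and $t\in[s_k,s_{k+1})$, $$x(t)=T_{t-s_k}x(s_k)+\int_0^{t-s_k}T_{t-s_k-\tau}f_{\sigma(\tau+s_k)}\big(x(\tau+s_k),K(T_\tau x(s_k))\big)\,d\tau ,$$ and its transition map is $\phi(t,x_0,\sigma)=x(t)$. The maximal sampling time is $\sup_{k\ge0}(s_{k+1}-s_k)$. **Theorem.** Suppose that $\Sigma_0$ is uniformly semi-globally exponentially stable: for every $r>0$ there are $M(r)>0$ and $\lambda(r)>0$ such that $$\|\phi_0(t,x,\sigma)\|\le M(r)e^{-\lambda(r)t}\|x\|\qquad\text{for all }t\ge0,\ \|x\|\le r,\ \sigma\in\mathrm{PC};$$ and suppose that $\lim_{r\to\infty} r/M(r)=+\infty$. Then for every $r>0$ there exists $\delta^\star(r)>0$ such that, for every sequence of sampling instants whose maximal sampling time is smaller than $\delta^\star(r)$, the system $\Sigma$ has exactly one solution on $\mathbb R_+$ for each $x_0\in X$ and $\sigma\in\mathrm{PC}$, and it is uniformly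 exponentially stable at the origin in $B_X(0,r)$: there are $M>0$ and $\lambda>0$ with $$\|\phi(t,x,\sigma)\|\le Me^{-\lambda t}\|x\|\qquad\text{for all }t\ge0,\ \|x\|\le r,\ \sigma\in\mathrm{PC}.$$ -/

import Mathlib

open Set Filter Topology
open scoped NNReal ENNReal

/-- `T` is a `C₀`-group of bounded linear operators on `X`. -/
structure IsC0Group {X : Type*} [NormedAddCommGroup X] [NormedSpace ℝ X]
    (T : ℝ → X →L[ℝ] X) : Prop where
  map_zero : T 0 = ContinuousLinearMap.id ℝ X
  map_add : ∀ s t : ℝ, T (s + t) = (T s).comp (T t)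
  strongly_continuous : ∀ x : X, Continuous fun t : ℝ => T t x

/-- The (unbounded) operator `A` is the infinitesimal generator of the group `T`: `x` lies in the
domain of `A` and `A x = y` exactly when `(T h x - x) / h` tends to `y` as `h → 0`. -/
def IsInfinitesimalGenerator {X : Type*} [NormedAddCommGroup X] [NormedSpace ℝ X]
    (A : X →ₗ.[ℝ] X) (T : ℝ → X →L[ℝ] X) : Prop :=
  ∀ x y : X, (x, y) ∈ A.graph ↔
    Tendsto (fun h : ℝ => h⁻¹ • (T h x - x)) (𝓝[≠] (0 : ℝ)) (𝓝 y)

/-- The class `PC` of piecewise constant switching signals on `[0, ∞)`. Signals are functions on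
`ℝ`; their values at negative times are never used. -/
def piecewiseConstantSignals (𝒬 : Type*) : Set (ℝ → 𝒬) :=
  {σ | ∃ (t : ℕ → ℝ) (q : ℕ → 𝒬), t 0 = 0 ∧ StrictMono t ∧ Tendsto t atTop atTop ∧
    ∀ k : ℕ, ∀ τ ∈ Ico (t k) (t (k + 1)), σ τ = q k}

/-- `x` is the (mild) solution on `[0, ∞)`, starting at `x₀`, of the switching system
`x' = A x + f_σ(x, u)` in closed loop with `u = K(x)`, where `A` generates `T`. -/
def IsClosedLoopSolution {X U 𝒬 : Type*} [NormedAddCommGroup X] [NormedSpace ℝ X]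
    (T : ℝ → X →L[ℝ] X) (f : 𝒬 → X × U → X) (K : X → U)
    (x₀ : X) (σ : ℝ → 𝒬) (x : ℝ → X) : Prop :=
  ContinuousOn x (Ici 0) ∧
  ∀ t : ℝ, 0 ≤ t →
    x t = T t x₀ + ∫ s in (0 : ℝ)..t, T (t - s) (f (σ s) (x s, K (x s)))

/-- `s` is a sequence of sampling instants `0 = s₀ < s₁ < ⋯` tending to infinity. -/
structure IsSamplingSequence (s : ℕ → ℝ) : Prop where
  zero : s 0 = 0
  strictMono : StrictMono s
  tendsto : Tendsto s atTop atTop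

/-- The maximal sampling time `sup_k (s_{k+1} - s_k)`, possibly infinite. -/
noncomputable def maximalSamplingTime (s : ℕ → ℝ) : ℝ≥0∞ :=
  ⨆ k : ℕ, ENNReal.ofReal (s (k + 1) - s k)

/-- `x` is a solution on `[0, ∞)`, starting at `x₀`, of the switching system
`x' = A x + f_σ(x, u)` with the predictor-based sampled-data controller
`u(t) = K(T_{t - s_k} x(s_k))` for `s_k ≤ t < s_{k+1}`. -/
def IsSampledSolution {X U 𝒬 : Type*} [NormedAddCommGroup X] [NormedSpace ℝ X]
    (T : ℝ → X →L[ℝ] X) (f : 𝒬 → X × U → X) (K : X → U) (s : ℕ → ℝ)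
    (x₀ : X) (σ : ℝ → 𝒬) (x : ℝ → X) : Prop :=
  ContinuousOn x (Ici 0) ∧ x 0 = x₀ ∧
  ∀ k : ℕ, ∀ t ∈ Ico (s k) (s (k + 1)),
    x t = T (t - s k) (x (s k)) +
      ∫ τ in (0 : ℝ)..(t - s k),
        T (t - s k - τ) (f (σ (τ + s k)) (x (τ + s k), K (T τ (x (s k)))))

/-- For every initial state and every signal of the class `S`, the system whose solutions are given
by `Sol` has exactly one solution on `[0, ∞)`. -/
def IsWellPosed {X 𝒬 : Type*} (Sol : X → (ℝ → 𝒬) → (ℝ → X) → Prop) (S : Set (ℝ → 𝒬)) : Prop :=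
  ∀ x₀ : X, ∀ σ ∈ S, ∃ x : ℝ → X, Sol x₀ σ x ∧ ∀ y : ℝ → X, Sol x₀ σ y → EqOn y x (Ici 0)

/-- The transition map `(t, x₀, σ) ↦ x(t)`, with `x` the solution starting at `x₀` for the
signal `σ`, of the system whose solutions are given by `Sol`. -/
noncomputable def transitionMap {X 𝒬 : Type*} [Nonempty X]
    (Sol : X → (ℝ → 𝒬) → (ℝ → X) → Prop) (t : ℝ) (x₀ : X) (σ : ℝ → 𝒬) : X :=
  Classical.epsilon (fun x : ℝ → X => Sol x₀ σ x) t

/-- Uniform exponential stability at the origin in the closed ball `B(0, R)`. -/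
def IsUESInBall {X 𝒬 : Type*} [NormedAddCommGroup X]
    (S : Set (ℝ → 𝒬)) (φ : ℝ → X → (ℝ → 𝒬) → X) (R : ℝ) : Prop :=
  ∃ M > (0 : ℝ), ∃ lam > (0 : ℝ), ∀ t : ℝ, 0 ≤ t → ∀ x : X, ‖x‖ ≤ R → ∀ σ ∈ S,
    ‖φ t x σ‖ ≤ M * Real.exp (-lam * t) * ‖x‖

/-- Uniform semi-global exponential stability at the origin, with the gain `M(r)` and the decay
rate `lam(r)` in the ball `B(0, r)`, `r > 0`. -/
def IsUSGESWith {X 𝒬 : Type*} [NormedAddCommGroup X]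
    (S : Set (ℝ → 𝒬)) (φ : ℝ → X → (ℝ → 𝒬) → X) (M lam : ℝ → ℝ) : Prop :=
  ∀ r : ℝ, 0 < r → 0 < M r ∧ 0 < lam r ∧
    ∀ t : ℝ, 0 ≤ t → ∀ x : X, ‖x‖ ≤ r → ∀ σ ∈ S,
      ‖φ t x σ‖ ≤ M r * Real.exp (-lam r * t) * ‖x‖

/-! In the variable `y t = T (-t) (x t)` the group disappears. Both systems become `y' = G t (y t)
(y (κ t))` with the same field `pulledField`, Lipschitz on bounded time intervals uniformly in the
signal. The closed loop has `κ t = t`. Since `T (t - s k) (x (s k)) = T t (y (s k))`, the predictor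
merely freezes `y` at the last sample, so the sampled system has `κ = lastSample s`.

Well-posedness is then Picard iteration. Over one sampling interval of length at most `δ`, `y` moves
by `O(δ) * ‖x₀‖`, so the two solutions stay that close on bounded intervals
(`exists_sampled_sub_closedLoop_le`). The relative form of the error is essential: it yields
exponential decay and not just practical stability.

In the ball of radius `r`, take `a` after which the closed-loop gain is below 1/4, and `δ` making
the relative error at most 1/4 on `[0, a + 1]`. Sampled solutions are halved throughout `[a, a +
1]`, which contains a sampling instant. The state there is again in the ball, so the argument
repeats from it (`sampled_exponential_decay`). -/

/-! ### Retarded Volterra equations: uniqueness, growth, dependence on the delay, existence. -/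

section Volterra

open MeasureTheory Real

variable {X : Type*} [NormedAddCommGroup X] [NormedSpace ℝ X]

/-- The rate `2 * L` is chosen so that integrating `L * m * exp (2 * L * s)` turns `m` into `m / 2`:
in this weight the integral operator is a contraction. -/
theorem norm_integral_le_exp_add {g : ℝ → X} {L m D t : ℝ} (hm : 0 ≤ m)
    (ht : 0 ≤ t) (h : ∀ s ∈ Icc 0 t, ‖g s‖ ≤ L * (m * exp (2 * L * s) + D)) :
    ‖∫ s in (0 : ℝ)..t, g s‖ ≤ L * D * t + m / 2 * exp (2 * L * t) := by
  have hc : Continuous fun s : ℝ => L * (m * exp (2 * L * s) + D) := by fun_prop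
  have h1 : ‖∫ s in (0 : ℝ)..t, g s‖ ≤ ∫ s in (0 : ℝ)..t, L * (m * exp (2 * L * s) + D) :=
    intervalIntegral.norm_integral_le_of_norm_le ht
      (Eventually.of_forall fun s hs => h s ⟨hs.1.le, hs.2⟩) (hc.intervalIntegrable _ _)
  have h2 : ∫ s in (0 : ℝ)..t, L * (m * exp (2 * L * s) + D)
      = (L * D * t + m / 2 * exp (2 * L * t)) - (L * D * 0 + m / 2 * exp (2 * L * 0)) := by
    refine intervalIntegral.integral_eq_sub_of_hasDerivAt (f := fun s : ℝ =>
      L * D * s + m / 2 * exp (2 * L * s)) (fun s _ => ?_) (hc.intervalIntegrable _ _)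
    have h3 : HasDerivAt (fun s : ℝ => 2 * L * s) (2 * L) s := by
      simpa using (hasDerivAt_id s).const_mul (2 * L)
    have h4 : HasDerivAt (fun s : ℝ => L * D * s) (L * D) s := by
      simpa using (hasDerivAt_id s).const_mul (L * D)
    exact (h4.add (h3.exp.const_mul (m / 2))).congr_deriv (by ring)
  rw [h2] at h1
  have : exp (2 * L * 0) = 1 := by simp
  rw [this] at h1
  linarith

/-- Grönwall by self-improvement: the best constant `m` is attained by compactness, and the
hypothesis at the maximum point gives `m ≤ c + m / 2`, up to a weight that is at least 1. -/
theorem le_two_mul_exp_of_weighted_bound {u : ℝ → ℝ} {b μ c : ℝ} (hb : 0 ≤ b) (hμ : 0 ≤ μ)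
    (hu : ContinuousOn u (Icc 0 b)) (hu0 : ∀ t ∈ Icc 0 b, 0 ≤ u t)
    (h : ∀ m, 0 ≤ m → (∀ s ∈ Icc 0 b, u s ≤ m * exp (μ * s)) →
      ∀ t ∈ Icc 0 b, u t ≤ c + m / 2 * exp (μ * t)) :
    ∀ t ∈ Icc 0 b, u t ≤ 2 * c * exp (μ * t) := by
  obtain ⟨t₀, ht₀, hmax⟩ := isCompact_Icc.exists_isMaxOn (nonempty_Icc.2 hb)
    (f := fun t => u t * exp (-(μ * t))) (hu.mul (by fun_prop))
  set m := u t₀ * exp (-(μ * t₀)) with hm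
  have hm0 : 0 ≤ m := mul_nonneg (hu0 _ ht₀) (exp_pos _).le
  have key : ∀ s ∈ Icc 0 b, u s ≤ m * exp (μ * s) := by
    intro s hs
    have := mul_le_mul_of_nonneg_right (hmax hs) (exp_pos (μ * s)).le
    simp only [mul_assoc, ← exp_add] at this
    simpa [hm, mul_assoc, ← exp_add] using this
  have h1 := h m hm0 key t₀ ht₀
  have h2 : m * exp (μ * t₀) = u t₀ := by
    rw [hm, mul_assoc, ← exp_add]; simp
  have h3 : 1 ≤ exp (μ * t₀) := one_le_exp (mul_nonneg hμ ht₀.1)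
  have h4 : m ≤ 2 * c := by
    have : m * exp (μ * t₀) ≤ 2 * c := by linarith
    nlinarith
  intro t ht
  exact (key t ht).trans (mul_le_mul_of_nonneg_right h4 (exp_pos _).le)

/-- `G` is Lipschitz in its two state arguments with constant `L`, uniformly on `[0, b]`. -/
def LipschitzFieldOn (G : ℝ → X → X → X) (b L : ℝ) : Prop :=
  ∀ s ∈ Icc 0 b, ∀ v w v' w' : X, ‖G s v w - G s v' w'‖ ≤ L * max ‖v - v'‖ ‖w - w'‖

/-- The right-hand side of the retarded equation `y' = G t (y t) (y (κ t))`, where `κ` is a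
retarded argument: the regularity that Picard iteration needs. -/
structure IsRetardedField (G : ℝ → X → X → X) (κ : ℝ → ℝ) : Prop where
  lipschitz : ∀ b : ℝ, ∃ L > 0, LipschitzFieldOn G b L
  zero : ∀ s, G s 0 0 = 0
  measurable : ∀ y : ℝ → X, Continuous y →
    AEStronglyMeasurable (fun s => G s (y s) (y (κ s))) (volume.restrict (Ici 0))
  mem_Icc : ∀ s, 0 ≤ s → κ s ∈ Icc 0 s

/-- The integral form of `y' = G t (y t) (y (κ t))`, `y 0 = x₀`, on `[0, ∞)`. -/
def IsRetardedSolution (G : ℝ → X → X → X) (κ : ℝ → ℝ) (x₀ : X) (y : ℝ → X) : Prop :=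
  ContinuousOn y (Ici 0) ∧
    ∀ t, 0 ≤ t → y t = x₀ + ∫ s in (0 : ℝ)..t, G s (y s) (y (κ s))

variable {G : ℝ → X → X → X} {κ : ℝ → ℝ}

omit [NormedSpace ℝ X] in
theorem LipschitzFieldOn.norm_le {b L : ℝ} (h : LipschitzFieldOn G b L) (h0 : ∀ s, G s 0 0 = 0)
    {s : ℝ} (hs : s ∈ Icc 0 b) (v w : X) : ‖G s v w‖ ≤ L * max ‖v‖ ‖w‖ := by
  simpa [h0] using h s hs v w 0 0

omit [NormedSpace ℝ X] in
theorem IsRetardedField.integrable (h : IsRetardedField G κ) {y : ℝ → X}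
    (hy : ContinuousOn y (Ici 0)) {a b : ℝ} (ha : 0 ≤ a) (hb : 0 ≤ b) :
    IntervalIntegrable (fun s => G s (y s) (y (κ s))) volume a b := by
  -- The field `measurable` asks for continuity on all of `ℝ`, so `y` is extended by `y 0` to
  -- negative times.
  have hz : Continuous fun s => y (max s 0) :=
    hy.comp_continuous (by fun_prop) fun s => mem_Ici.2 (le_max_right _ _)
  suffices H : ∀ b, 0 ≤ b → IntervalIntegrable (fun s => G s (y s) (y (κ s))) volume 0 b from
    (H a ha).symm.trans (H b hb)
  intro b hb
  obtain ⟨L, hL, hLip⟩ := h.lipschitz b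
  obtain ⟨C, hC⟩ := isCompact_Icc.exists_bound_of_continuousOn
    (hy.mono (Icc_subset_Ici_self : Icc (0 : ℝ) b ⊆ Ici 0))
  rw [intervalIntegrable_iff_integrableOn_Icc_of_le hb]
  refine IntegrableOn.of_bound (by simp) ?_ (L * C) ?_
  · have h1 := (h.measurable _ hz).mono_measure
      (Measure.restrict_mono (Icc_subset_Ici_self : Icc (0 : ℝ) b ⊆ Ici 0) le_rfl)
    refine h1.congr ?_
    filter_upwards [ae_restrict_mem measurableSet_Icc] with s hs
    rw [max_eq_left hs.1, max_eq_left (h.mem_Icc s hs.1).1]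
  · filter_upwards [ae_restrict_mem measurableSet_Icc] with s hs
    have hk := h.mem_Icc s hs.1
    refine (hLip.norm_le h.zero hs _ _).trans (mul_le_mul_of_nonneg_left ?_ hL.le)
    exact max_le (hC s hs) (hC _ ⟨hk.1, hk.2.trans hs.2⟩)

/-- The weight is increasing, so looking back in time costs nothing. -/
theorem weighted_retard {u : ℝ → ℝ} {b L m s : ℝ} (hL : 0 < L) (hm : 0 ≤ m)
    (hκ : κ s ∈ Icc 0 s) (hs : s ∈ Icc 0 b)
    (h : ∀ s ∈ Icc 0 b, u s ≤ m * exp (2 * L * s)) : u (κ s) ≤ m * exp (2 * L * s) := by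
  refine (h _ ⟨hκ.1, hκ.2.trans hs.2⟩).trans (mul_le_mul_of_nonneg_left (exp_le_exp.2 ?_) hm)
  exact mul_le_mul_of_nonneg_left hκ.2 (by positivity)

theorem IsRetardedField.integral_sub_le (h : IsRetardedField G κ) {b L : ℝ} (hL : 0 < L)
    (hLip : LipschitzFieldOn G b L) {y z : ℝ → X} (hy : ContinuousOn y (Ici 0))
    (hz : ContinuousOn z (Ici 0)) {m : ℝ} (hm : 0 ≤ m)
    (hyz : ∀ s ∈ Icc 0 b, ‖y s - z s‖ ≤ m * exp (2 * L * s)) {t : ℝ} (ht : t ∈ Icc 0 b) :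
    ‖(∫ s in (0 : ℝ)..t, G s (y s) (y (κ s))) - ∫ s in (0 : ℝ)..t, G s (z s) (z (κ s))‖
      ≤ m / 2 * exp (2 * L * t) := by
  rw [← intervalIntegral.integral_sub (h.integrable hy le_rfl ht.1) (h.integrable hz le_rfl ht.1)]
  refine (norm_integral_le_exp_add (L := L) (D := 0) hm ht.1 fun s hs => ?_).trans (by simp)
  have hs' : s ∈ Icc 0 b := ⟨hs.1, hs.2.trans ht.2⟩
  refine (hLip s hs' _ _ _ _).trans (mul_le_mul_of_nonneg_left ?_ hL.le)
  rw [add_zero]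
  exact max_le (hyz s hs') (weighted_retard (u := fun s => ‖y s - z s‖) hL hm
    (h.mem_Icc s hs.1) hs' hyz)

theorem IsRetardedField.eqOn (h : IsRetardedField G κ) {x₀ : X} {y z : ℝ → X}
    (hy : IsRetardedSolution G κ x₀ y) (hz : IsRetardedSolution G κ x₀ z) :
    EqOn y z (Ici 0) := by
  intro b hb
  obtain ⟨L, hL, hLip⟩ := h.lipschitz b
  have hsub : Icc 0 b ⊆ Ici (0 : ℝ) := Icc_subset_Ici_self
  have := le_two_mul_exp_of_weighted_bound (u := fun s => ‖y s - z s‖) (b := b) (μ := 2 * L)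
    (c := 0) hb (by positivity) ((hy.1.mono hsub).sub (hz.1.mono hsub)).norm
    (fun _ _ => norm_nonneg _) (fun m hm hu t ht => ?_) b ⟨hb, le_rfl⟩
  · simpa [sub_eq_zero] using this
  · rw [hy.2 t ht.1, hz.2 t ht.1, add_sub_add_left_eq_sub, zero_add]
    exact h.integral_sub_le hL hLip hy.1 hz.1 hm hu ht

/-- A priori growth bound. -/
theorem IsRetardedField.norm_le (h : IsRetardedField G κ) {b L : ℝ} (hb : 0 ≤ b) (hL : 0 < L)
    (hLip : LipschitzFieldOn G b L) {x₀ : X} {y : ℝ → X} (hy : IsRetardedSolution G κ x₀ y) :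
    ∀ t ∈ Icc 0 b, ‖y t‖ ≤ 2 * ‖x₀‖ * exp (2 * L * t) := by
  have hsub : Icc 0 b ⊆ Ici (0 : ℝ) := Icc_subset_Ici_self
  refine le_two_mul_exp_of_weighted_bound (u := fun s => ‖y s‖) hb (by positivity)
    (hy.1.mono hsub).norm (fun _ _ => norm_nonneg _) (fun m hm hu t ht => ?_)
  rw [hy.2 t ht.1]
  refine (norm_add_le _ _).trans (add_le_add le_rfl ?_)
  -- The comparison is with the zero function, on which the field vanishes.
  simpa [h.zero] using h.integral_sub_le (z := fun _ => 0) hL hLip hy.1 continuousOn_const hm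
    (by simpa using hu) ht

/-- Retarding the argument by at most `δ` moves the solution by `O(δ)` on bounded intervals. -/
theorem IsRetardedField.norm_sub_le {κ' : ℝ → ℝ} (h : IsRetardedField G κ)
    (h' : IsRetardedField G κ') {b L δ : ℝ} (hb : 0 ≤ b) (hL : 0 < L)
    (hLip : LipschitzFieldOn G b L) (hκ' : ∀ s, κ' s = s)
    (hδ : ∀ s, 0 ≤ s → s - κ s ≤ δ) {x₀ : X} {y z : ℝ → X}
    (hy : IsRetardedSolution G κ x₀ y) (hz : IsRetardedSolution G κ' x₀ z) :
    ∀ t ∈ Icc 0 b, ‖y t - z t‖ ≤ 4 * L ^ 2 * b * exp (2 * L * b) ^ 2 * δ * ‖x₀‖ := by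
  have hsub : Icc 0 b ⊆ Ici (0 : ℝ) := Icc_subset_Ici_self
  have hδ0 : 0 ≤ δ := by
    have h1 := hδ 0 le_rfl
    have h2 := (h.mem_Icc 0 le_rfl).2
    linarith
  set E := exp (2 * L * b) with hE
  have hE0 : 0 < E := exp_pos _
  have hEle : ∀ t ∈ Icc 0 b, exp (2 * L * t) ≤ E := fun t ht =>
    exp_le_exp.2 (mul_le_mul_of_nonneg_left ht.2 (by positivity))
  have hgrow : ∀ t ∈ Icc 0 b, ‖y t‖ ≤ 2 * ‖x₀‖ * E := fun t ht =>
    (h.norm_le hb hL hLip hy t ht).trans (mul_le_mul_of_nonneg_left (hEle t ht) (by positivity))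
  -- Speed bound for `y` on `[0, b]` times the longest delay.
  set D := L * (2 * ‖x₀‖ * E) * δ with hD
  have hD0 : 0 ≤ D := by positivity
  have hret : ∀ s ∈ Icc 0 b, ‖y (κ s) - y s‖ ≤ D := by
    intro s hs
    have hk := h.mem_Icc s hs.1
    rw [hy.2 s hs.1, hy.2 _ hk.1, add_sub_add_left_eq_sub,
      intervalIntegral.integral_interval_sub_left (h.integrable hy.1 le_rfl hk.1)
        (h.integrable hy.1 le_rfl hs.1)]
    refine (intervalIntegral.norm_integral_le_of_norm_le_const (C := L * (2 * ‖x₀‖ * E))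
      fun τ hτ => ?_).trans ?_
    · rw [uIoc_comm, uIoc_of_le hk.2] at hτ
      have hτ' : τ ∈ Icc 0 b := ⟨hk.1.trans hτ.1.le, hτ.2.trans hs.2⟩
      have hkτ := h.mem_Icc τ hτ'.1
      refine (hLip.norm_le h.zero hτ' _ _).trans (mul_le_mul_of_nonneg_left ?_ hL.le)
      exact max_le (hgrow _ hτ') (hgrow _ ⟨hkτ.1, hkτ.2.trans hτ'.2⟩)
    · rw [abs_sub_comm, abs_of_nonneg (sub_nonneg.2 hk.2)]
      exact mul_le_mul_of_nonneg_left (hδ s hs.1) (by positivity)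
  intro t ht
  have key := le_two_mul_exp_of_weighted_bound (u := fun s => ‖y s - z s‖) (b := b) (μ := 2 * L)
    (c := L * D * b) hb (by positivity)
    ((hy.1.mono hsub).sub (hz.1.mono hsub)).norm
    (fun _ _ => norm_nonneg _) (fun m hm hu t ht => ?_) t ht
  · refine (key.trans (mul_le_mul_of_nonneg_left (hEle t ht) (by positivity))).trans (le_of_eq ?_)
    rw [hD]; ring
  · rw [hy.2 t ht.1, hz.2 t ht.1, add_sub_add_left_eq_sub, ← intervalIntegral.integral_sub
      (h.integrable hy.1 le_rfl ht.1) (h'.integrable hz.1 le_rfl ht.1)]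
    refine (norm_integral_le_exp_add (D := D) hm ht.1 fun s hs => ?_).trans
      (add_le_add (mul_le_mul_of_nonneg_left ht.2 (by positivity)) le_rfl)
    have hs' : s ∈ Icc 0 b := ⟨hs.1, hs.2.trans ht.2⟩
    refine (hLip s hs' _ _ _ _).trans (mul_le_mul_of_nonneg_left ?_ hL.le)
    have h1 := hu s hs'
    refine max_le (by linarith) ?_
    rw [hκ']
    -- Passing through `y s` separates the effect of the delay from the distance of the solutions.
    have h2 := norm_sub_le_norm_sub_add_norm_sub (y (κ s)) (y s) (z s)
    have h3 := hret s hs'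
    linarith

/-- One Picard step. The time is truncated at `0`, which keeps the iterates continuous on `ℝ`. -/
noncomputable def picardStep (G : ℝ → X → X → X) (κ : ℝ → ℝ) (x₀ : X) (y : ℝ → X) (t : ℝ) : X :=
  x₀ + ∫ s in (0 : ℝ)..(max t 0), G s (y s) (y (κ s))

theorem IsRetardedField.continuous_primitive (h : IsRetardedField G κ) {y : ℝ → X}
    (hy : ContinuousOn y (Ici 0)) :
    ContinuousOn (fun t => ∫ s in (0 : ℝ)..t, G s (y s) (y (κ s))) (Ici 0) := by
  intro t ht
  have ht' : (0 : ℝ) ≤ t := ht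
  have ht1 : 0 ≤ t + 1 := by linarith
  have h1 := intervalIntegral.continuousOn_primitive_interval' (h.integrable hy le_rfl ht1)
    left_mem_uIcc
  rw [uIcc_of_le ht1] at h1
  refine (h1 t ⟨ht', by linarith⟩).mono_of_mem_nhdsWithin ?_
  exact mem_nhdsWithin.2 ⟨Iio (t + 1), isOpen_Iio, by simp, fun s hs => ⟨hs.2, le_of_lt hs.1⟩⟩

theorem IsRetardedField.continuous_picardStep (h : IsRetardedField G κ) (x₀ : X) {y : ℝ → X}
    (hy : ContinuousOn y (Ici 0)) : Continuous (picardStep G κ x₀ y) :=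
  continuous_const.add ((h.continuous_primitive hy).comp_continuous
    (continuous_id.max continuous_const) fun _ => mem_Ici.2 (le_max_right _ _))

/-- On each `[0, b]` successive iterates differ by a multiple of `(1 / 2) ^ n`, hence converge
uniformly there, and the contraction estimate carries the limit through the integral. -/
theorem IsRetardedField.exists_solution [CompleteSpace X] (h : IsRetardedField G κ) (x₀ : X) :
    ∃ y, IsRetardedSolution G κ x₀ y := by
  set Y : ℕ → ℝ → X := fun n => (picardStep G κ x₀)^[n] (fun _ => x₀) with hY
  have hYs : ∀ n, Y (n + 1) = picardStep G κ x₀ (Y n) := fun n =>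
    Function.iterate_succ_apply' _ _ _
  have hYc : ∀ n, Continuous (Y n) := by
    intro n
    induction n with
    | zero => exact continuous_const
    | succ n ih => rw [hYs]; exact h.continuous_picardStep x₀ ih.continuousOn
  have hstep : ∀ n, ∀ t, 0 ≤ t → Y (n + 1) t = x₀ + ∫ s in (0 : ℝ)..t, G s (Y n s) (Y n (κ s)) := by
    intro n t ht
    rw [hYs, picardStep, max_eq_left ht]
  have hbound : ∀ b, 0 ≤ b → ∃ L > 0, LipschitzFieldOn G b L ∧ ∃ m, 0 ≤ m ∧ ∀ n, ∀ t ∈ Icc 0 b,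
      ‖Y n t - Y (n + 1) t‖ ≤ m * (1 / 2) ^ n * exp (2 * L * t) := by
    intro b hb
    obtain ⟨L, hL, hLip⟩ := h.lipschitz b
    obtain ⟨m, hm⟩ := isCompact_Icc.exists_bound_of_continuousOn (s := Icc 0 b)
      ((hYc 0).sub (hYc 1)).continuousOn
    have hm0 : 0 ≤ m := (norm_nonneg _).trans (hm 0 ⟨le_rfl, hb⟩)
    refine ⟨L, hL, hLip, m, hm0, fun n => ?_⟩
    induction n with
    | zero =>
      intro t ht
      have : 1 ≤ exp (2 * L * t) := one_le_exp (by have := ht.1; positivity)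
      simpa using (hm t ht).trans (le_mul_of_one_le_right hm0 this)
    | succ n ih =>
      intro t ht
      rw [hstep n t ht.1, hstep (n + 1) t ht.1, add_sub_add_left_eq_sub]
      refine (h.integral_sub_le hL hLip (hYc n).continuousOn (hYc (n + 1)).continuousOn
        (by positivity) ih ht).trans (le_of_eq ?_)
      ring
  have hdist : ∀ b, 0 ≤ b → ∃ L > 0, LipschitzFieldOn G b L ∧ ∃ C, 0 ≤ C ∧ ∀ t ∈ Icc 0 b, ∀ n,
      dist (Y n t) (Y (n + 1) t) ≤ C * (1 / 2) ^ n := by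
    intro b hb
    obtain ⟨L, hL, hLip, m, hm, H⟩ := hbound b hb
    refine ⟨L, hL, hLip, m * exp (2 * L * b), by positivity, fun t ht n => ?_⟩
    rw [dist_eq_norm]
    refine (H n t ht).trans ?_
    have : exp (2 * L * t) ≤ exp (2 * L * b) :=
      exp_le_exp.2 (mul_le_mul_of_nonneg_left ht.2 (by positivity))
    calc _ ≤ m * (1 / 2) ^ n * exp (2 * L * b) := mul_le_mul_of_nonneg_left this (by positivity)
      _ = _ := by ring
  -- The limit is taken pointwise, so it does not depend on `b` and nothing has to be glued.
  have hlim : ∀ t, ∃ a, 0 ≤ t → Tendsto (fun n => Y n t) atTop (𝓝 a) := by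
    intro t
    by_cases ht : 0 ≤ t
    · obtain ⟨L, -, -, C, -, H⟩ := hdist t ht
      obtain ⟨a, ha⟩ := cauchySeq_tendsto_of_complete
        (cauchySeq_of_le_geometric (1 / 2) C (by norm_num) (H t ⟨ht, le_rfl⟩))
      exact ⟨a, fun _ => ha⟩
    · exact ⟨0, fun h => absurd h ht⟩
  choose y hy using hlim
  have hrate : ∀ b, 0 ≤ b → ∃ L > 0, LipschitzFieldOn G b L ∧ ∃ C, 0 ≤ C ∧ ∀ n, ∀ t ∈ Icc 0 b,
      ‖Y n t - y t‖ ≤ C * (1 / 2) ^ n := by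
    intro b hb
    obtain ⟨L, hL, hLip, C, hC, H⟩ := hdist b hb
    refine ⟨L, hL, hLip, 2 * C, by positivity, fun n t ht => ?_⟩
    rw [← dist_eq_norm]
    refine (dist_le_of_le_geometric_of_tendsto (1 / 2) C (by norm_num) (H t ht)
      (hy t ht.1) n).trans (le_of_eq ?_)
    ring
  have hpow : ∀ C : ℝ, Tendsto (fun n : ℕ => C * (1 / 2 : ℝ) ^ n) atTop (𝓝 0) := fun C => by
    simpa using (tendsto_pow_atTop_nhds_zero_of_lt_one (by norm_num : (0:ℝ) ≤ 1 / 2)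
      (by norm_num)).const_mul C
  have hyc : ContinuousOn y (Ici 0) := by
    intro t ht
    have ht' : (0 : ℝ) ≤ t := ht
    obtain ⟨L, -, -, C, hC, H⟩ := hrate (t + 1) (by linarith)
    have hu : TendstoUniformlyOn Y y atTop (Icc 0 (t + 1)) := by
      rw [Metric.tendstoUniformlyOn_iff]
      intro ε hε
      filter_upwards [(hpow C).eventually (gt_mem_nhds hε)] with n hn s hs
      rw [dist_comm, dist_eq_norm]
      exact (H n s hs).trans_lt hn
    refine (hu.continuousOn (Frequently.of_forall fun n => (hYc n).continuousOn) t
      ⟨ht', by linarith⟩).mono_of_mem_nhdsWithin ?_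
    exact mem_nhdsWithin.2
      ⟨Iio (t + 1), isOpen_Iio, by simp, fun s hs => ⟨hs.2, le_of_lt hs.1⟩⟩
  refine ⟨y, hyc, fun t ht => ?_⟩
  obtain ⟨L, hL, hLip, C, hC, H⟩ := hrate t ht
  refine tendsto_nhds_unique ((hy t ht).comp (tendsto_add_atTop_nat 1)) ?_
  rw [tendsto_iff_norm_sub_tendsto_zero]
  refine squeeze_zero (fun _ => norm_nonneg _) (fun n => ?_) (hpow (C / 2 * exp (2 * L * t)))
  simp only [Function.comp_apply]
  rw [hstep n t ht, add_sub_add_left_eq_sub]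
  refine (h.integral_sub_le hL hLip (hYc n).continuousOn hyc
    (m := C * (1 / 2) ^ n) (by positivity) (fun s hs => ?_) ⟨ht, le_rfl⟩).trans (le_of_eq ?_)
  · refine (H n s hs).trans (le_mul_of_one_le_right (by positivity) (one_le_exp ?_))
    have := hs.1
    positivity
  · ring

end Volterra

/-! ### The group, the pulled-back equations, and time shifts. -/

section Translation

open MeasureTheory

variable {X U 𝒬 : Type*} [NormedAddCommGroup X] [NormedSpace ℝ X]
  [NormedAddCommGroup U] {T : ℝ → X →L[ℝ] X}

theorem IsC0Group.neg_apply (hT : IsC0Group T) (t : ℝ) (x : X) : T (-t) (T t x) = x := by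
  rw [← ContinuousLinearMap.comp_apply, ← hT.map_add, neg_add_cancel, hT.map_zero]; rfl

theorem IsC0Group.apply_neg (hT : IsC0Group T) (t : ℝ) (x : X) : T t (T (-t) x) = x := by
  simpa using hT.neg_apply (-t) x

theorem IsC0Group.add_apply (hT : IsC0Group T) (s t : ℝ) (x : X) : T (s + t) x = T s (T t x) := by
  rw [hT.map_add]; rfl

theorem IsC0Group.exists_bound [CompleteSpace X] (hT : IsC0Group T) (b : ℝ) :
    ∃ C, 1 ≤ C ∧ ∀ s ∈ Icc (-b) b, ‖T s‖ ≤ C := by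
  obtain ⟨C, hC⟩ := banach_steinhaus (g := fun s : Icc (-b) b => T s) fun x => by
    obtain ⟨C, hC⟩ := isCompact_Icc.exists_bound_of_continuousOn
      ((hT.strongly_continuous x).continuousOn (s := Icc (-b) b))
    exact ⟨C, fun s => hC s s.2⟩
  exact ⟨max 1 C, le_max_left _ _, fun s hs => (hC ⟨s, hs⟩).trans (le_max_right _ _)⟩

/-- Strong continuity becomes joint continuity because the norms are locally bounded, by
Banach–Steinhaus. -/
theorem IsC0Group.continuous_uncurry [CompleteSpace X] (hT : IsC0Group T) :
    Continuous fun p : ℝ × X => T p.1 p.2 := by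
  rw [continuous_iff_continuousAt]
  rintro ⟨t₀, x₀⟩
  obtain ⟨C, hC1, hC⟩ := hT.exists_bound (|t₀| + 1)
  rw [ContinuousAt, tendsto_iff_norm_sub_tendsto_zero]
  have h1 : Tendsto (fun p : ℝ × X => C * ‖p.2 - x₀‖ + ‖T p.1 x₀ - T t₀ x₀‖) (𝓝 (t₀, x₀))
      (𝓝 0) := by
    have h2 := (hT.strongly_continuous x₀).comp (continuous_fst (X := ℝ) (Y := X))
    have : Continuous (fun p : ℝ × X => C * ‖p.2 - x₀‖ + ‖T p.1 x₀ - T t₀ x₀‖) :=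
      (continuous_const.mul (continuous_snd.sub continuous_const).norm).add
        (h2.sub continuous_const).norm
    simpa using this.tendsto (t₀, x₀)
  refine squeeze_zero' (Eventually.of_forall fun _ => norm_nonneg _) ?_ h1
  have h3 : ∀ᶠ p : ℝ × X in 𝓝 (t₀, x₀), |p.1| < |t₀| + 1 :=
    (continuous_fst.abs.tendsto (t₀, x₀)).eventually (gt_mem_nhds (lt_add_one _))
  filter_upwards [h3] with p hp
  have h4 : T p.1 p.2 - T t₀ x₀ = T p.1 (p.2 - x₀) + (T p.1 x₀ - T t₀ x₀) := by
    rw [map_sub]; abel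
  rw [h4]
  refine (norm_add_le _ _).trans (add_le_add ?_ le_rfl)
  exact (T p.1).le_of_opNorm_le (hC _ (abs_le.1 hp.le)) _

/-- The nonlinearity in the variable `y t = T (-t) (x t)`. -/
def pulledField (T : ℝ → X →L[ℝ] X) (f : 𝒬 → X × U → X) (K : X → U) (σ : ℝ → 𝒬)
    (s : ℝ) (v w : X) : X :=
  T (-s) (f (σ s) (T s v, K (T s w)))

variable {f : 𝒬 → X × U → X} {K : X → U} {Lf LK : ℝ≥0}

theorem exists_lipschitzFieldOn_pulledField [CompleteSpace X] (hT : IsC0Group T)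
    (hf : ∀ q : 𝒬, LipschitzWith Lf (f q)) (hK : LipschitzWith LK K) (b : ℝ) :
    ∃ L > 0, ∀ σ : ℝ → 𝒬, LipschitzFieldOn (pulledField T f K σ) b L := by
  obtain ⟨C, hC1, hC⟩ := hT.exists_bound b
  have hC0 : 0 < C := by linarith
  -- The outer `C` bounds `T (-s)`, the inner one `T s`; `LK + 1` dominates both components of the
  -- pair. No factor depends on `σ`.
  refine ⟨C * ((Lf + 1) * ((LK + 1) * C)), by positivity, fun σ s hs v w v' w' => ?_⟩
  have hb : 0 ≤ b := hs.1.trans hs.2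
  have hs1 : ‖T s‖ ≤ C := hC s ⟨by linarith [hs.1], hs.2⟩
  have hs2 : ‖T (-s)‖ ≤ C := hC (-s) ⟨by linarith [hs.2], by linarith [hs.1]⟩
  set m := max ‖v - v'‖ ‖w - w'‖ with hm
  have hm0 : 0 ≤ m := (norm_nonneg _).trans (le_max_left _ _)
  have hv : ‖T s v - T s v'‖ ≤ C * m := by
    rw [← map_sub]
    exact ((T s).le_of_opNorm_le hs1 _).trans
      (mul_le_mul_of_nonneg_left (le_max_left _ _) hC0.le)
  have hw : ‖T s w - T s w'‖ ≤ C * m := by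
    rw [← map_sub]
    exact ((T s).le_of_opNorm_le hs1 _).trans
      (mul_le_mul_of_nonneg_left (le_max_right _ _) hC0.le)
  have hLf : (0 : ℝ) ≤ Lf := Lf.2
  have hLK : (0 : ℝ) ≤ LK := LK.2
  have hCm : 0 ≤ C * m := by positivity
  have hpair : ‖((T s v, K (T s w)) : X × U) - (T s v', K (T s w'))‖ ≤ (LK + 1) * (C * m) := by
    refine max_le (hv.trans ?_) ((hK.norm_sub_le _ _).trans ?_)
    · nlinarith
    · have := mul_le_mul_of_nonneg_left hw hLK
      nlinarith
  unfold pulledField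
  rw [← map_sub, mul_assoc]
  refine ((T (-s)).le_of_opNorm_le hs2 _).trans (mul_le_mul_of_nonneg_left ?_ hC0.le)
  refine ((hf (σ s)).norm_sub_le _ _).trans ?_
  have h0 : 0 ≤ (LK + 1 : ℝ) * (C * m) := by positivity
  have := mul_le_mul_of_nonneg_left hpair hLf
  nlinarith

theorem exists_mem_Ico_of_tendsto {t : ℕ → ℝ} (h0 : t 0 = 0) (ht : Tendsto t atTop atTop) {a : ℝ}
    (ha : 0 ≤ a) : ∃ k, a ∈ Ico (t k) (t (k + 1)) := by
  have hex : ∃ n, a < t n := (ht.eventually_gt_atTop a).exists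
  classical
  have h1 := Nat.find_spec hex
  obtain ⟨k, hk⟩ : ∃ k, Nat.find hex = k + 1 := Nat.exists_eq_succ_of_ne_zero fun h => by
    rw [h, h0] at h1; linarith
  refine ⟨k, not_lt.1 (Nat.find_min hex (by omega)), hk ▸ h1⟩

theorem isRetardedField_pulledField [CompleteSpace X] (hT : IsC0Group T)
    (hf : ∀ q : 𝒬, LipschitzWith Lf (f q)) (hf0 : ∀ q : 𝒬, f q (0, 0) = 0)
    (hK : LipschitzWith LK K) (hK0 : K 0 = 0) {σ : ℝ → 𝒬}
    (hσ : σ ∈ piecewiseConstantSignals 𝒬) {κ : ℝ → ℝ} (hκ : Measurable κ)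
    (hκ' : ∀ s, 0 ≤ s → κ s ∈ Icc 0 s) : IsRetardedField (pulledField T f K σ) κ := by
  refine ⟨fun b => ?_, fun s => ?_, fun y hy => ?_, hκ'⟩
  · obtain ⟨L, hL, h⟩ := exists_lipschitzFieldOn_pulledField hT hf hK b
    exact ⟨L, hL, h σ⟩
  · simp [pulledField, hK0, hf0]
  · obtain ⟨t, q, h0, -, ht, hq⟩ := hσ
    -- Measurability is checked on each interval of constancy of `σ`, where the field is jointly
    -- continuous.
    have hcover : Ici (0 : ℝ) ⊆ ⋃ k, Ico (t k) (t (k + 1)) := fun a ha =>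
      mem_iUnion.2 (exists_mem_Ico_of_tendsto h0 ht ha)
    refine AEStronglyMeasurable.mono_measure ?_ (Measure.restrict_mono hcover le_rfl)
    rw [aestronglyMeasurable_iUnion_iff]
    intro k
    have hTc := hT.continuous_uncurry
    have hF : Continuous fun p : ℝ × X × X => T (-p.1) (f (q k) (T p.1 p.2.1, K (T p.1 p.2.2))) := by
      have h1 : Continuous fun p : ℝ × X × X => T p.1 p.2.1 :=
        hTc.comp (continuous_fst.prodMk continuous_snd.fst)
      have h2 : Continuous fun p : ℝ × X × X => T p.1 p.2.2 :=
        hTc.comp (continuous_fst.prodMk continuous_snd.snd)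
      have h3 := (hf (q k)).continuous.comp (h1.prodMk (hK.continuous.comp h2))
      exact hTc.comp (continuous_fst.neg.prodMk h3)
    have hm : StronglyMeasurable fun s =>
        T (-s) (f (q k) (T s (y s), K (T s (y (κ s))))) :=
      hF.comp_stronglyMeasurable (stronglyMeasurable_id.prodMk
        (hy.stronglyMeasurable.prodMk (hy.comp_stronglyMeasurable hκ.stronglyMeasurable)))
    refine hm.aestronglyMeasurable.congr ?_
    filter_upwards [ae_restrict_mem measurableSet_Ico] with s hs
    simp only [pulledField, hq k s hs]

omit [NormedAddCommGroup U] in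
-- `T (t - s) = T t ∘ T (-s)`, and `T t` comes out of the integral.
theorem isRetardedSolution_iff_isClosedLoopSolution [CompleteSpace X] (hT : IsC0Group T)
    {σ : ℝ → 𝒬} (hG : IsRetardedField (pulledField T f K σ) fun s => s) {x₀ : X} {x : ℝ → X} :
    IsClosedLoopSolution T f K x₀ σ x ↔
      IsRetardedSolution (pulledField T f K σ) (fun s => s) x₀ fun t => T (-t) (x t) := by
  have hcont : ∀ {x : ℝ → X}, ContinuousOn x (Ici 0) → ContinuousOn (fun t => T (-t) (x t)) (Ici 0) :=
    fun h => hT.continuous_uncurry.comp_continuousOn (continuousOn_neg.prodMk h)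
  have hcont' : ContinuousOn (fun t => T (-t) (x t)) (Ici 0) → ContinuousOn x (Ici 0) := fun h =>
    (hT.continuous_uncurry.comp_continuousOn (continuousOn_id.prodMk h)).congr
      fun t _ => (hT.apply_neg t (x t)).symm
  have hint : ContinuousOn x (Ici 0) → ∀ t, 0 ≤ t →
      ∫ s in (0 : ℝ)..t, T (t - s) (f (σ s) (x s, K (x s))) =
      T t (∫ s in (0 : ℝ)..t, pulledField T f K σ s (T (-s) (x s)) (T (-s) (x s))) := by
    intro hx t ht
    rw [← (T t).intervalIntegral_comp_comm (hG.integrable (hcont hx) le_rfl ht)]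
    refine intervalIntegral.integral_congr fun s _ => ?_
    simp only [pulledField, hT.apply_neg, ← hT.add_apply, sub_eq_add_neg]
  constructor
  · rintro ⟨hx, h⟩
    refine ⟨hcont hx, fun t ht => ?_⟩
    dsimp only
    rw [h t ht, hint hx t ht, ← map_add, hT.neg_apply]
  · rintro ⟨hx, h⟩
    have hx' := hcont' hx
    refine ⟨hx', fun t ht => ?_⟩
    rw [hint hx' t ht, ← map_add, ← h t ht, hT.apply_neg]

/-- The last sampling instant before `t`. -/
noncomputable def lastSample (s : ℕ → ℝ) (t : ℝ) : ℝ := ⨆ k, if s k ≤ t then s k else 0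

theorem measurable_lastSample (s : ℕ → ℝ) : Measurable (lastSample s) :=
  Measurable.iSup fun _ => Measurable.ite measurableSet_Ici measurable_const measurable_const

variable {s : ℕ → ℝ}

theorem IsSamplingSequence.nonneg (hs : IsSamplingSequence s) (k : ℕ) : 0 ≤ s k :=
  hs.zero ▸ hs.strictMono.monotone (Nat.zero_le k)

theorem IsSamplingSequence.lastSample_eq (hs : IsSamplingSequence s) {k : ℕ} {t : ℝ}
    (ht : t ∈ Ico (s k) (s (k + 1))) : lastSample s t = s k := by
  -- The default 0 for later samples is harmless because `0 ≤ s k`.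
  have hle : ∀ j, (if s j ≤ t then s j else 0) ≤ s k := by
    intro j
    split_ifs with h
    · exact hs.strictMono.monotone
        (Nat.lt_succ_iff.1 (hs.strictMono.lt_iff_lt.1 (h.trans_lt ht.2)))
    · exact hs.nonneg k
  refine le_antisymm (ciSup_le hle) ?_
  have := le_ciSup (f := fun j => if s j ≤ t then s j else 0)
    ⟨s k, by rintro _ ⟨j, rfl⟩; exact hle j⟩ k
  simpa [lastSample, ht.1] using this

theorem IsSamplingSequence.lastSample_mem_Icc (hs : IsSamplingSequence s) (t : ℝ) (ht : 0 ≤ t) :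
    lastSample s t ∈ Icc 0 t := by
  obtain ⟨k, hk⟩ := exists_mem_Ico_of_tendsto hs.zero hs.tendsto ht
  rw [hs.lastSample_eq hk]
  exact ⟨hs.nonneg k, hk.1⟩

theorem sub_lt_of_maximalSamplingTime_lt {δ : ℝ}
    (hδ : maximalSamplingTime s < ENNReal.ofReal δ) (k : ℕ) : s (k + 1) - s k < δ :=
  (ENNReal.ofReal_lt_ofReal_iff'.1
    ((le_iSup (fun k => ENNReal.ofReal (s (k + 1) - s k)) k).trans_lt hδ)).1

theorem IsSamplingSequence.sub_lastSample_le (hs : IsSamplingSequence s) {δ : ℝ}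
    (hδ : ∀ k, s (k + 1) - s k < δ) (t : ℝ) (ht : 0 ≤ t) : t - lastSample s t ≤ δ := by
  obtain ⟨k, hk⟩ := exists_mem_Ico_of_tendsto hs.zero hs.tendsto ht
  rw [hs.lastSample_eq hk]
  linarith [hδ k, hk.2]

omit [NormedSpace ℝ X] in
/-- A continuous function that keeps its value over every sampling interval is constant. -/
theorem IsSamplingSequence.eq_zero_of_eq_sample (hs : IsSamplingSequence s) {D : ℝ → X}
    (hD : ContinuousOn D (Ici 0)) (h0 : D 0 = 0)
    (h : ∀ k, ∀ t ∈ Ico (s k) (s (k + 1)), D t = D (s k)) : ∀ t, 0 ≤ t → D t = 0 := by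
  have hsamp : ∀ k, D (s k) = 0 := by
    intro k
    induction k with
    | zero => rw [hs.zero, h0]
    | succ k ih =>
      have hlt : s k < s (k + 1) := hs.strictMono (Nat.lt_succ_self k)
      -- The interval omits its right endpoint; the value there is a left limit.
      have hne : (𝓝[Ico (s k) (s (k + 1))] (s (k + 1))).NeBot := by
        rw [← mem_closure_iff_nhdsWithin_neBot, closure_Ico hlt.ne]
        exact right_mem_Icc.2 hlt.le
      have h1 := (hD (s (k + 1)) (hs.nonneg _)).mono
        (fun t (ht : t ∈ Ico (s k) (s (k + 1))) => mem_Ici.2 ((hs.nonneg k).trans ht.1))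
      refine tendsto_nhds_unique h1 (tendsto_const_nhds.congr' ?_)
      filter_upwards [self_mem_nhdsWithin] with t ht
      rw [h k t ht, ih]
  intro t ht
  obtain ⟨k, hk⟩ := exists_mem_Ico_of_tendsto hs.zero hs.tendsto ht
  rw [h k t hk, hsamp]

omit [NormedAddCommGroup U] in
-- The sampled equation restarts at every `s k`, the retarded one integrates from 0. Their pieces
-- match interval by interval, and continuity excludes jumps at the samples.
theorem isRetardedSolution_iff_isSampledSolution [CompleteSpace X] (hT : IsC0Group T)
    {σ : ℝ → 𝒬} (hs : IsSamplingSequence s)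
    (hG : IsRetardedField (pulledField T f K σ) (lastSample s)) {x₀ : X} {x : ℝ → X} :
    IsSampledSolution T f K s x₀ σ x ↔
      IsRetardedSolution (pulledField T f K σ) (lastSample s) x₀ fun t => T (-t) (x t) := by
  have hcont : ContinuousOn x (Ici 0) → ContinuousOn (fun t => T (-t) (x t)) (Ici 0) :=
    fun h => hT.continuous_uncurry.comp_continuousOn (continuousOn_neg.prodMk h)
  have hcont' : ContinuousOn (fun t => T (-t) (x t)) (Ici 0) → ContinuousOn x (Ici 0) := fun h =>
    (hT.continuous_uncurry.comp_continuousOn (continuousOn_id.prodMk h)).congr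
      fun t _ => (hT.apply_neg t (x t)).symm
  set I : ℝ → ℝ → X := fun a b => ∫ r in a..b,
    pulledField T f K σ r (T (-r) (x r)) (T (-lastSample s r) (x (lastSample s r))) with hI
  have hint : ContinuousOn x (Ici 0) → ∀ k, ∀ t ∈ Ico (s k) (s (k + 1)),
      (∫ τ in (0 : ℝ)..(t - s k),
        T (t - s k - τ) (f (σ (τ + s k)) (x (τ + s k), K (T τ (x (s k)))))) =
      T t (I (s k) t) := by
    intro hx k t ht
    have ht0 := (hs.nonneg k).trans ht.1
    have h1 := intervalIntegral.integral_comp_add_right (a := 0) (b := t - s k)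
      (fun r => T (t - r) (f (σ r) (x r, K (T (r - s k) (x (s k)))))) (s k)
    simp only [zero_add, sub_add_cancel, add_sub_cancel_right] at h1
    have h2 : ∀ τ, t - s k - τ = t - (τ + s k) := fun τ => by ring
    simp only [h2]
    rw [h1, hI, ← (T t).intervalIntegral_comp_comm (hG.integrable (hcont hx) (hs.nonneg k) ht0)]
    refine intervalIntegral.integral_congr fun r hr => ?_
    rw [uIcc_of_le ht.1] at hr
    simp only [pulledField, hT.apply_neg, hs.lastSample_eq ⟨hr.1, hr.2.trans_lt ht.2⟩,
      ← hT.add_apply, sub_eq_add_neg]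
  have hadd : ContinuousOn x (Ici 0) → ∀ a b, 0 ≤ a → 0 ≤ b → I 0 a + I a b = I 0 b :=
    fun hx a b ha hb => intervalIntegral.integral_add_adjacent_intervals
      (hG.integrable (hcont hx) le_rfl ha) (hG.integrable (hcont hx) ha hb)
  constructor
  · rintro ⟨hx, hx0, h⟩
    refine ⟨hcont hx, fun t ht => ?_⟩
    rw [← sub_eq_zero]
    refine hs.eq_zero_of_eq_sample (D := fun t => T (-t) (x t) - (x₀ + I 0 t))
      ((hcont hx).sub (continuousOn_const.add (hG.continuous_primitive (hcont hx)))) ?_ ?_ t ht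
    · simp [hI, hx0, hT.map_zero]
    · intro k t ht
      have ht0 := (hs.nonneg k).trans ht.1
      have h3 : T (-t) (x t) = T (-s k) (x (s k)) + I (s k) t := by
        rw [h k t ht, hint hx k t ht, map_add, hT.neg_apply, ← hT.add_apply]
        congr 3; ring
      rw [h3, ← hadd hx (s k) t (hs.nonneg k) ht0]
      abel
  · rintro ⟨hy, h⟩
    have hx := hcont' hy
    refine ⟨hx, by simpa [hT.map_zero] using h 0 le_rfl, fun k t ht => ?_⟩
    have ht0 := (hs.nonneg k).trans ht.1
    have h4 : T (-t) (x t) = T (-s k) (x (s k)) + I (s k) t := by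
      refine (h t ht0).trans ?_
      rw [show T (-s k) (x (s k)) = x₀ + I 0 (s k) from h (s k) (hs.nonneg k), add_assoc]
      exact congrArg _ (hadd hx (s k) t (hs.nonneg k) ht0).symm
    rw [hint hx k t ht, sub_eq_add_neg, hT.add_apply, ← map_add, ← h4, hT.apply_neg]

theorem comp_add_mem_piecewiseConstantSignals {σ : ℝ → 𝒬}
    (hσ : σ ∈ piecewiseConstantSignals 𝒬) {a : ℝ} (ha : 0 ≤ a) :
    (fun t => σ (t + a)) ∈ piecewiseConstantSignals 𝒬 := by
  obtain ⟨t, q, h0, hmono, ht, hq⟩ := hσ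
  obtain ⟨k, hk⟩ := exists_mem_Ico_of_tendsto h0 ht ha
  have hmax : ∀ j, max (t (k + (j + 1))) a = t (k + (j + 1)) := fun j =>
    max_eq_left (hk.2.le.trans (hmono.monotone (by omega)))
  -- The `max` acts only at `j = 0`, where it cuts the interval containing `a` so that the new
  -- partition starts at 0.
  refine ⟨fun j => max (t (k + j)) a - a, fun j => q (k + j), by simp [hk.1], ?_, ?_, ?_⟩
  · refine strictMono_nat_of_lt_succ fun j => ?_
    rw [hmax]
    refine sub_lt_sub_right (max_lt (hmono (by omega)) ?_) a
    exact hk.2.trans_le (hmono.monotone (by omega))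
  · refine tendsto_atTop_mono (fun j => sub_le_sub_right (le_max_left _ a) a) ?_
    simp only [sub_eq_add_neg]
    exact tendsto_atTop_add_const_right _ _
      (ht.comp (tendsto_add_atTop_nat k |>.congr fun j => add_comm j k))
  · intro j τ hτ
    simp only [hmax] at hτ
    refine hq (k + j) _ ⟨?_, ?_⟩
    · have := hτ.1
      linarith [le_max_left (t (k + j)) a]
    · have := hτ.2
      rw [← add_assoc] at this
      linarith

theorem IsSamplingSequence.shift (hs : IsSamplingSequence s) (j : ℕ) :
    IsSamplingSequence fun k => s (j + k) - s j := by
  refine ⟨by simp, fun a b hab => sub_lt_sub_right (hs.strictMono (by omega)) _, ?_⟩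
  simp only [sub_eq_add_neg]
  exact tendsto_atTop_add_const_right _ _
    (hs.tendsto.comp (tendsto_add_atTop_nat j |>.congr fun k => add_comm k j))

omit [NormedAddCommGroup U] in
-- The restart is at a sampling instant because in between the control still uses an earlier state.
theorem IsSampledSolution.shift (hs : IsSamplingSequence s) {x₀ : X} {σ : ℝ → 𝒬} {x : ℝ → X}
    (h : IsSampledSolution T f K s x₀ σ x) (j : ℕ) :
    IsSampledSolution T f K (fun k => s (j + k) - s j) (x (s j)) (fun t => σ (t + s j))
      fun t => x (t + s j) := by
  refine ⟨h.1.comp (by fun_prop) fun t ht => mem_Ici.2 (add_nonneg ht (hs.nonneg j)), by simp,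
    fun k t ht => ?_⟩
  have h1 := h.2.2 (j + k) (t + s j) ⟨by linarith [ht.1], by
    have := ht.2
    simp only [← add_assoc] at this
    linarith⟩
  have h2 : t + s j - s (j + k) = t - (s (j + k) - s j) := by ring
  have h3 : ∀ τ, τ + (s (j + k) - s j) + s j = τ + s (j + k) := fun τ => by ring
  simp only [h3, sub_add_cancel]
  rw [h1, h2]

end Translation

/-! ### Comparison with the closed loop and exponential decay. -/

section Stability

variable {X U 𝒬 : Type*} [NormedAddCommGroup X] [NormedSpace ℝ X] [CompleteSpace X]
  [NormedAddCommGroup U] {T : ℝ → X →L[ℝ] X} {f : 𝒬 → X × U → X} {K : X → U} {Lf LK : ℝ≥0}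

theorem exists_isClosedLoopSolution (hT : IsC0Group T)
    (hf : ∀ q : 𝒬, LipschitzWith Lf (f q)) (hf0 : ∀ q : 𝒬, f q (0, 0) = 0)
    (hK : LipschitzWith LK K) (hK0 : K 0 = 0) (x₀ : X) {σ : ℝ → 𝒬}
    (hσ : σ ∈ piecewiseConstantSignals 𝒬) : ∃ x, IsClosedLoopSolution T f K x₀ σ x := by
  have hG := isRetardedField_pulledField hT hf hf0 hK hK0 hσ measurable_id'
    (fun s hs => ⟨hs, le_rfl⟩)
  obtain ⟨y, hy⟩ := hG.exists_solution x₀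
  refine ⟨fun t => T t (y t), (isRetardedSolution_iff_isClosedLoopSolution hT hG).2 ?_⟩
  simpa only [hT.neg_apply] using hy

theorem isWellPosed_isSampledSolution (hT : IsC0Group T)
    (hf : ∀ q : 𝒬, LipschitzWith Lf (f q)) (hf0 : ∀ q : 𝒬, f q (0, 0) = 0)
    (hK : LipschitzWith LK K) (hK0 : K 0 = 0) {s : ℕ → ℝ} (hs : IsSamplingSequence s) :
    IsWellPosed (IsSampledSolution T f K s) (piecewiseConstantSignals 𝒬) := by
  intro x₀ σ hσ
  have hG := isRetardedField_pulledField hT hf hf0 hK hK0 hσ (measurable_lastSample s)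
    hs.lastSample_mem_Icc
  obtain ⟨y, hy⟩ := hG.exists_solution x₀
  have hx : IsSampledSolution T f K s x₀ σ fun t => T t (y t) := by
    refine (isRetardedSolution_iff_isSampledSolution hT hs hG).2 ?_
    simpa only [hT.neg_apply] using hy
  refine ⟨_, hx, fun z hz t ht => ?_⟩
  have := hG.eqOn ((isRetardedSolution_iff_isSampledSolution hT hs hG).1 hz) hy ht
  dsimp only at this ⊢
  rw [← this, hT.apply_neg]

/-- On bounded time intervals the sampled-data solutions are close to the closed-loop ones,
uniformly in the switching signal and relative to the size of the initial state. -/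
theorem exists_sampled_sub_closedLoop_le (hT : IsC0Group T)
    (hf : ∀ q : 𝒬, LipschitzWith Lf (f q)) (hf0 : ∀ q : 𝒬, f q (0, 0) = 0)
    (hK : LipschitzWith LK K) (hK0 : K 0 = 0) {b ε : ℝ} (hb : 0 ≤ b) (hε : 0 < ε) :
    ∃ δ > 0, ∀ s, IsSamplingSequence s → (∀ k, s (k + 1) - s k < δ) →
      ∀ σ ∈ piecewiseConstantSignals 𝒬, ∀ (x₀ : X) (x z : ℝ → X),
        IsSampledSolution T f K s x₀ σ x → IsClosedLoopSolution T f K x₀ σ z →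
          ∀ t ∈ Icc 0 b, ‖x t - z t‖ ≤ ε * ‖x₀‖ := by
  obtain ⟨C, hC1, hC⟩ := hT.exists_bound b
  obtain ⟨L, hL, hLip⟩ := exists_lipschitzFieldOn_pulledField hT hf hK b
  set D := 4 * L ^ 2 * b * Real.exp (2 * L * b) ^ 2 with hD
  have hD0 : 0 ≤ D := by positivity
  have hC0 : 0 < C := by linarith
  -- This makes `C * D * δ ≤ ε`; `D + 1` is used because `D` vanishes when `b = 0`.
  refine ⟨ε / (C * (D + 1)), by positivity, fun s hs hδ σ hσ x₀ x z hx hz t ht => ?_⟩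
  set δ := ε / (C * (D + 1)) with hδ'
  have hG := isRetardedField_pulledField hT hf hf0 hK hK0 hσ (measurable_lastSample s)
    hs.lastSample_mem_Icc
  have hG' := isRetardedField_pulledField hT hf hf0 hK hK0 hσ measurable_id'
    (fun s hs => ⟨hs, le_rfl⟩)
  have h1 := hG.norm_sub_le hG' hb hL (hLip σ) (fun _ => rfl) (hs.sub_lastSample_le hδ)
    ((isRetardedSolution_iff_isSampledSolution hT hs hG).1 hx)
    ((isRetardedSolution_iff_isClosedLoopSolution hT hG').1 hz) t ht
  rw [← map_sub] at h1
  have h2 : ‖x t - z t‖ ≤ C * (D * δ * ‖x₀‖) := by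
    rw [← hT.apply_neg t (x t - z t)]
    exact ((T t).le_of_opNorm_le (hC t ⟨by linarith [ht.1], ht.2⟩) _).trans
      (mul_le_mul_of_nonneg_left h1 hC0.le)
  refine h2.trans ?_
  rw [← mul_assoc, ← mul_assoc]
  refine mul_le_mul_of_nonneg_right ?_ (norm_nonneg _)
  rw [hδ', mul_div_assoc', div_le_iff₀ (by positivity)]
  nlinarith [mul_pos hC0 hε]

omit [CompleteSpace X] [NormedAddCommGroup U] in
/-- If sampled solutions starting in a ball are bounded on `[0, a + 1]` and halved on `[a, a + 1]`,
then they decay exponentially: restart the system at a sampling instant in `[a, a + 1]`. -/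
theorem sampled_exponential_decay {a N r δ : ℝ} (ha : 0 < a) (hδ : δ ≤ 1) (hN : 0 < N)
    (hwin : ∀ s, IsSamplingSequence s → (∀ k, s (k + 1) - s k < δ) →
      ∀ σ ∈ piecewiseConstantSignals 𝒬, ∀ (x₀ : X) (x : ℝ → X), ‖x₀‖ ≤ r →
        IsSampledSolution T f K s x₀ σ x →
          (∀ t ∈ Icc 0 (a + 1), ‖x t‖ ≤ N * ‖x₀‖) ∧
          ∀ t ∈ Icc a (a + 1), ‖x t‖ ≤ 1 / 2 * ‖x₀‖) :
    ∀ s, IsSamplingSequence s → (∀ k, s (k + 1) - s k < δ) →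
      ∀ σ ∈ piecewiseConstantSignals 𝒬, ∀ (x₀ : X) (x : ℝ → X), ‖x₀‖ ≤ r →
        IsSampledSolution T f K s x₀ σ x → ∀ t, 0 ≤ t →
          ‖x t‖ ≤ 2 * N * Real.exp (-(Real.log 2 / (a + 1)) * t) * ‖x₀‖ := by
  -- With this rate `exp (-α * t)` is still at least 1/2 at `t = a + 1`, so one halving pays for a
  -- whole window, and the factor 2 in `2 * N` pays for the last one.
  set α := Real.log 2 / (a + 1) with hα
  have hα0 : 0 < α := div_pos (Real.log_pos (by norm_num)) (by linarith)
  have hexp : ∀ t, t ≤ a + 1 → 1 / 2 ≤ Real.exp (-α * t) := by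
    intro t ht
    have h1 : α * (a + 1) = Real.log 2 := by rw [hα]; field_simp
    have h2 : (1 : ℝ) / 2 = Real.exp (-Real.log 2) := by
      rw [Real.exp_neg, Real.exp_log (by norm_num)]; norm_num
    rw [h2, Real.exp_le_exp, ← h1]
    nlinarith
  -- Each restart occurs at a time at least `a`, so it shortens the horizon `n * a` by one unit;
  -- sampling sequence, signal and state all change and must stay general.
  suffices H : ∀ n : ℕ, ∀ s, IsSamplingSequence s → (∀ k, s (k + 1) - s k < δ) →
      ∀ σ ∈ piecewiseConstantSignals 𝒬, ∀ (x₀ : X) (x : ℝ → X), ‖x₀‖ ≤ r →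
        IsSampledSolution T f K s x₀ σ x → ∀ t, 0 ≤ t → t ≤ n * a →
          ‖x t‖ ≤ 2 * N * Real.exp (-α * t) * ‖x₀‖ by
    intro s hs hsδ σ hσ x₀ x hx₀ hx t ht
    obtain ⟨n, hn⟩ := exists_nat_ge (t / a)
    exact H n s hs hsδ σ hσ x₀ x hx₀ hx t ht ((div_le_iff₀ ha).1 hn)
  intro n
  induction n with
  | zero =>
    intro s hs hsδ σ hσ x₀ x hx₀ hx t ht htn
    have ht0 : t = 0 := le_antisymm (by simpa using htn) ht
    have := (hwin s hs hsδ σ hσ x₀ x hx₀ hx).1 t ⟨ht, by linarith⟩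
    rw [ht0] at this ⊢
    simp only [mul_zero, Real.exp_zero, mul_one]
    nlinarith [mul_nonneg hN.le (norm_nonneg x₀)]
  | succ n ih =>
    intro s hs hsδ σ hσ x₀ x hx₀ hx t ht htn
    obtain ⟨hbd, hhalf⟩ := hwin s hs hsδ σ hσ x₀ x hx₀ hx
    by_cases htb : t ≤ a + 1
    · refine (hbd t ⟨ht, htb⟩).trans (mul_le_mul_of_nonneg_right ?_ (norm_nonneg _))
      nlinarith [hexp t htb]
    · obtain ⟨k, hk⟩ := exists_mem_Ico_of_tendsto hs.zero hs.tendsto ha.le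
      -- The first sample after `a` comes less than `δ ≤ 1` later, hence inside the halving window.
      set j := k + 1 with hj
      have hja : a ≤ s j := hk.2.le
      have hjb : s j ≤ a + 1 := by linarith [hsδ k, hk.1]
      have hx_j := hhalf (s j) ⟨hja, hjb⟩
      have h1 := ih _ (hs.shift j) (fun i => by
          have := hsδ (j + i)
          rw [add_assoc] at this
          linarith) _ (comp_add_mem_piecewiseConstantSignals hσ (hs.nonneg j)) _ _
        (hx_j.trans (by linarith [norm_nonneg x₀])) (hx.shift hs j) (t - s j) (by linarith)
        (by push_cast at htn; linarith)
      simp only [sub_add_cancel] at h1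
      have h2 : Real.exp (-α * (t - s j)) * Real.exp (-α * s j) = Real.exp (-α * t) := by
        rw [← Real.exp_add]; congr 1; ring
      have h3 := hexp (s j) hjb
      calc ‖x t‖ ≤ 2 * N * Real.exp (-α * (t - s j)) * ‖x (s j)‖ := h1
        _ ≤ 2 * N * Real.exp (-α * (t - s j)) * (Real.exp (-α * s j) * ‖x₀‖) :=
          mul_le_mul_of_nonneg_left
            (hx_j.trans (mul_le_mul_of_nonneg_right h3 (norm_nonneg _))) (by positivity)
        _ = _ := by rw [← h2]; ring

end Stability

theorem mainTheorem7 {X U 𝒬 : Type*}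
    [NormedAddCommGroup X] [NormedSpace ℝ X] [CompleteSpace X]
    [NormedAddCommGroup U] [NormedSpace ℝ U] [CompleteSpace U] [Nonempty 𝒬]
    (A : X →ₗ.[ℝ] X) (T : ℝ → X →L[ℝ] X)
    (hT : IsC0Group T) (hA : IsInfinitesimalGenerator A T)
    (f : 𝒬 → X × U → X) (Lf : ℝ≥0) (hf : ∀ q : 𝒬, LipschitzWith Lf (f q))
    (hf0 : ∀ q : 𝒬, f q (0, 0) = 0)
    (K : X → U) (LK : ℝ≥0) (hK : LipschitzWith LK K) (hK0 : K 0 = 0)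
    (M lam : ℝ → ℝ)
    (hstab : IsUSGESWith (piecewiseConstantSignals 𝒬)
      (transitionMap (IsClosedLoopSolution T f K)) M lam)
    (hM : Tendsto (fun r : ℝ => r / M r) atTop atTop) :
    ∀ r : ℝ, 0 < r → ∃ δ : ℝ, 0 < δ ∧
      ∀ s : ℕ → ℝ, IsSamplingSequence s → maximalSamplingTime s < ENNReal.ofReal δ →
        IsWellPosed (IsSampledSolution T f K s) (piecewiseConstantSignals 𝒬) ∧
        IsUESInBall (piecewiseConstantSignals 𝒬)
          (transitionMap (IsSampledSolution T f K s)) r := by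
 
  intro r hr
  obtain ⟨hMr, hlam, hdecay⟩ := hstab r hr
  -- The transition map is an `epsilon` choice, so it is a solution as soon as one exists.
  have hclosed : ∀ x₀ : X, ‖x₀‖ ≤ r → ∀ σ ∈ piecewiseConstantSignals 𝒬,
      ∃ z, IsClosedLoopSolution T f K x₀ σ z ∧
        ∀ t, 0 ≤ t → ‖z t‖ ≤ M r * Real.exp (-lam r * t) * ‖x₀‖ := fun x₀ hx₀ σ hσ =>
    ⟨_, Classical.epsilon_spec (exists_isClosedLoopSolution hT hf hf0 hK hK0 x₀ hσ),
      fun t ht => hdecay t ht x₀ hx₀ σ hσ⟩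
  have hlim : Tendsto (fun t => M r * Real.exp (-lam r * t)) atTop (𝓝 0) := by
    have h1 : Tendsto (fun t => -lam r * t) atTop atBot :=
      tendsto_id.const_mul_atTop_of_neg (neg_lt_zero.2 hlam)
    simpa using (Real.tendsto_exp_atBot.comp h1).const_mul (M r)
  -- Gain 1/4 here plus relative error 1/4 from `hclose` gives the factor 1/2.
  obtain ⟨a, ha4, ha⟩ := ((hlim.eventually (gt_mem_nhds (by norm_num : (0 : ℝ) < 1 / 4))).and
    (eventually_gt_atTop 0)).exists
  have hanti : ∀ t₁ t₂, t₁ ≤ t₂ →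
      M r * Real.exp (-lam r * t₂) ≤ M r * Real.exp (-lam r * t₁) := fun t₁ t₂ h =>
    mul_le_mul_of_nonneg_left (Real.exp_le_exp.2 (by nlinarith)) hMr.le
  obtain ⟨δ, hδ, hclose⟩ := exists_sampled_sub_closedLoop_le hT hf hf0 hK hK0
    (by linarith : 0 ≤ a + 1) (by norm_num : (0 : ℝ) < 1 / 4)
  -- The bound 1 guarantees a sampling instant in `[a, a + 1]`.
  refine ⟨min δ 1, lt_min hδ one_pos, fun s hs hsδ => ?_⟩
  have hwell := isWellPosed_isSampledSolution hT hf hf0 hK hK0 hs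
  refine ⟨hwell, 2 * (M r + 1 / 4), by linarith, Real.log 2 / (a + 1),
    div_pos (Real.log_pos (by norm_num)) (by linarith), fun t ht x₀ hx₀ σ hσ => ?_⟩
  refine sampled_exponential_decay (N := M r + 1 / 4) (r := r) (δ := min δ 1) ha
    (min_le_right _ _) (by linarith) ?_ s hs (sub_lt_of_maximalSamplingTime_lt hsδ) σ hσ x₀
    _ hx₀ (Classical.epsilon_spec ((hwell x₀ σ hσ).imp fun _ h => h.1)) t ht
  intro s hs hsδ σ hσ x₀ x hx₀ hx
  obtain ⟨z, hz, hzle⟩ := hclosed x₀ hx₀ σ hσ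
  have hle : ∀ t ∈ Icc 0 (a + 1), ∀ c, M r * Real.exp (-lam r * t) ≤ c →
      ‖x t‖ ≤ (c + 1 / 4) * ‖x₀‖ := by
    intro t ht c hc
    have h1 := hclose s hs (fun k => (hsδ k).trans_le (min_le_left _ _)) σ hσ x₀ x z hx hz t ht
    have h2 := (hzle t ht.1).trans (mul_le_mul_of_nonneg_right hc (norm_nonneg _))
    have h3 : ‖x t‖ ≤ ‖x t - z t‖ + ‖z t‖ := by
      simpa using norm_add_le (x t - z t) (z t)
    linarith
  refine ⟨fun t ht => hle t ht _ ?_, fun t ht => ?_⟩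
  · simpa using hanti 0 t ht.1
  · have := hle t ⟨ha.le.trans ht.1, ht.2⟩ (1 / 4) ((hanti a t ht.1).trans ha4.le)
    norm_num at this ⊢
    exact this
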